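/- Let $\chi_J$ be the Dirichlet character modulo $8$ with $\chi_J(m)=1$ for $m\equiv\pm1\pmod 8$, $\chi_J(m)=-1$ for $m\equiv\pm3\pmod 8$ and $\chi_J(m)=0$ for even $m$. Let $J$ be the infinite symmetric matrix with entries $J_{s,t}=\chi_J\left(\binom{s+t}{s}\right)$, $s,t\ge 0$, and let $J(n)$ be the $n\times n$ matrix formed by its entries with $0\le s,t<n$. Let $e:\mathbb N\to\mathbb Z$ be the $8$-periodic function with values $e(0),\dots,e(7)=0,0,1,-1,0,-2,3,-1$, and set $$g(n)=(-1)^n\prod_{k\ge 0}3^{e(\lfloor n/2^k\rfloor)}$$ (a finite product, since $e(0)=0$). Then for every $n\ge 0$ $$\det J(n)=\prod_{k=0}^{n-1}g(k)\in\pm 3^{\mathbb N}=\{\pm 3^m : m\in\mathbb N\}.$$ Moreover, let $\mathcal A=\prod_{n\ge0}M_{2^n\times2^n}(\mathbb C)$ be the algebra of sequences $A=(A[0],A[1],\dots)$ with componentwise operations. For $s,t\in\{0,1\}$ let $\rho(s,t)$ be the linear endomorphism of $\mathcal A$ for which $(\rho(s,t)A)[n]$ is the $2^n\times 2^n$ corner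 of $A[n+1]$ formed by its first (if $s=0$) or last (if $s=1$) $2^n$ rows and its first (if $t=0$) or last (if $t=1$) $2^n$ columns. The complexity of $A\in\mathcal A$ is the dimension, in $\mathbb N\cup\{\infty\}$, of the smallest linear subspace of $\mathcal A$ that contains $A$ and is stable under the four maps $\rho(s,t)$. An infinite matrix with rows and columns indexed by $\mathbb N$ is identified with the element of $\mathcal A$ whose $n$-th term is its upper left $2^n\times2^n$ submatrix. Then $J$ has complexity $9$, and $J=LDL^t$ in $\mathcal A$ for some infinite lower triangular matrix $L$ with all diagonal entries $1$, of complexity $20$, and some infinite diagonal matrix $D$, of complexity $4$. -/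

import Mathlib

namespace JacobiPascal

/-- The infinite symmetric matrix `J` with entries `χ_J (binom (s+t) s)`, `s, t = 0, 1, 2, …`.
Mathlib's `ZMod.χ₈` is the Dirichlet character mod `8` that is `1` on `±1`, `-1` on `±3`
and `0` on even residues. -/
def pascalJ : Matrix ℕ ℕ ℤ :=
  Matrix.of fun s t => ZMod.χ₈ (((s + t).choose s : ℕ) : ZMod 8)

/-- The `n × n` matrix `J(n)`, formed by the rows and columns `0 ≤ s, t < n` of `J`. -/
def J (n : ℕ) : Matrix (Fin n) (Fin n) ℤ :=
  pascalJ.submatrix (fun i => (i : ℕ)) (fun j => (j : ℕ))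

/-- The `8`-periodic function `e`. -/
def e (k : ℕ) : ℤ :=
  (![0, 0, 1, -1, 0, -2, 3, -1] : Fin 8 → ℤ) (Fin.ofNat 8 k)

/-- `g n = (-1)^n ∏_{k ≥ 0} 3^{e ⌊n / 2^k⌋}`; the product has only finitely many factors
different from `1`, see `finite_mulSupport_g`. -/
noncomputable def g (n : ℕ) : ℚ :=
  (-1) ^ n * ∏ᶠ k : ℕ, (3 : ℚ) ^ e (n / 2 ^ k)

theorem finite_mulSupport_g (n : ℕ) :
    (Function.mulSupport fun k : ℕ => (3 : ℚ) ^ e (n / 2 ^ k)).Finite := by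
  refine (Set.finite_Iio n).subset fun k hk => ?_
  by_contra h
  apply hk
  have h2 : n / 2 ^ k = 0 :=
    Nat.div_eq_of_lt (lt_of_le_of_lt (not_lt.mp h) Nat.lt_two_pow_self)
  simp only [h2]
  simp [e]

/-- The complex algebra `𝒜 = ∏_n M_{2^n × 2^n}(ℂ)` of sequences `A[0], A[1], A[2], …` of complex
square matrices, with the componentwise operations. -/
abbrev MatSeq : Type :=
  (n : ℕ) → Matrix (Fin (2 ^ n)) (Fin (2 ^ n)) ℂ

/-- Position, in a matrix of size `2^(n+1)`, of the `i`-th row or column of its first (`s = 0`)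
or last (`s = 1`) half. -/
def half {n : ℕ} (s : Fin 2) (i : Fin (2 ^ n)) : Fin (2 ^ (n + 1)) :=
  ⟨(s : ℕ) * 2 ^ n + i, by
    have hs : (s : ℕ) ≤ 1 := Nat.lt_succ_iff.mp s.isLt
    have h1 : (s : ℕ) * 2 ^ n ≤ 1 * 2 ^ n := Nat.mul_le_mul_right _ hs
    have h2 := i.isLt
    rw [pow_succ]
    omega⟩

/-- The shift map `ρ(s,t)`: it takes `A` to the sequence whose `n`-th matrix is the
`(s,t)`-corner, of size `2^n`, of `A[n+1]`. -/
def shift (s t : Fin 2) : MatSeq →ₗ[ℂ] MatSeq where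
  toFun A := fun n => (A (n + 1)).submatrix (half s) (half t)
  map_add' _ _ := rfl
  map_smul' _ _ := rfl

/-- A subspace of `𝒜` is recursively closed if it is stable under the four shift maps. -/
def RecursivelyClosed (V : Submodule ℂ MatSeq) : Prop :=
  ∀ s t : Fin 2, ∀ A ∈ V, shift s t A ∈ V

/-- The recursive closure of `A`: the smallest recursively closed subspace containing `A`. -/
def recClosure (A : MatSeq) : Submodule ℂ MatSeq :=
  sInf {V | RecursivelyClosed V ∧ A ∈ V}

/-- The complexity of `A`: the dimension, in `ℕ ∪ {∞}`, of its recursive closure. -/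
noncomputable def complexity (A : MatSeq) : ℕ∞ :=
  Cardinal.toENat (Module.rank ℂ (recClosure A))

/-- The transpose `A[0]ᵗ, A[1]ᵗ, A[2]ᵗ, …` of a sequence of matrices. -/
def transposeSeq (A : MatSeq) : MatSeq :=
  fun n => (A n).transpose

/-- The element of `𝒜` given by an infinite matrix `M`: its `n`-th matrix is formed by the first
`2^n` rows and columns of `M`. -/
def toSeq (M : Matrix ℕ ℕ ℂ) : MatSeq :=
  fun n => M.submatrix (fun i : Fin (2 ^ n) => (i : ℕ)) (fun j : Fin (2 ^ n) => (j : ℕ))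

end JacobiPascal

/-! All three matrices are produced by finite automata: a finite family of matrix sequences
("states") whose four corners are rational combinations of states. In a space stable under corners,
an element vanishes as soon as all `1 × 1` entries in the space vanish, because every entry of
`A[n]` is the `1 × 1` entry of an `n`-fold corner of `A`. Identities between automata thus become
finite linear algebra.

For `J`, the input is the self-similarity `pascalJ_add`: adding `4 * 2 ^ n` to one argument
multiplies the entry by the sign `(-1) ^ (s / 2 ^ n)`. It rests on Kummer's theorem
(`not_even_choose_iff`) and on extending `χ_J` multiplicatively through odd parts. So `J`, its two
off-diagonal corners and the nonzero corners of these, nine states in all, close up. For `D`, the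
analogous recursion is `g_add`. `L` is defined by an explicit table of 20 states.

The products of a state of `L`, a state of `D` and a transposed state of `L` again form an
automaton, since block multiplication turns corners of products into sums of products of corners.
Starting from `L D Lᵗ - J`, a finite stable space with vanishing `1 × 1` entries is computed, which
proves the factorization (`jSeq_eq`). As `L` is unitriangular, the determinant is the product of the
`g k`. It is an integer and, up to sign, a power of `3` with integral exponent, so the exponent can
be taken nonnegative.

For the complexities, every state is an iterated corner of the first one, and finitely many entries
separate the states (`IsAutomaton.complexity_eq`). -/

namespace JacobiPascal

/-! ### Sparse linear forms with rational coefficients -/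

/-- A formal rational linear combination of generators numbered by `ℕ`. -/
abbrev Form : Type := List (ℕ × ℚ)

namespace Form

variable {M : Type*} [AddCommGroup M] [Module ℚ M] (G : ℕ → M)

/-- The value of a form when the `k`-th generator is `G k`. -/
def ev (f : Form) : M := (f.map fun p => p.2 • G p.1).sum

@[simp] theorem ev_nil : ev G [] = 0 := rfl

@[simp] theorem ev_cons (p : ℕ × ℚ) (f : Form) : ev G (p :: f) = p.2 • G p.1 + ev G f := by
  simp [ev]

theorem ev_append (f f' : Form) : ev G (f ++ f') = ev G f + ev G f' := by
  simp [ev]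

theorem map_ev {M' : Type*} [AddCommGroup M'] [Module ℚ M'] (φ : M →ₗ[ℚ] M') (f : Form) :
    φ (ev G f) = ev (fun k => φ (G k)) f := by
  induction f with
  | nil => simp
  | cons p f ih => simp [ih]

theorem ev_mem {W : Submodule ℚ M} {f : Form} (h : ∀ p ∈ f, G p.1 ∈ W) : ev G f ∈ W := by
  induction f with
  | nil => simp
  | cons p f ih =>
    rw [ev_cons]
    exact W.add_mem (W.smul_mem _ (h p (by simp))) (ih fun q hq => h q (by simp [hq]))

/-- Add `c` times the `k`-th generator to a form sorted by generators. -/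
def ins (k : ℕ) (c : ℚ) : Form → Form
  | [] => if c = 0 then [] else [(k, c)]
  | (l, d) :: f =>
    if k < l then (if c = 0 then (l, d) :: f else (k, c) :: (l, d) :: f)
    else if k = l then (if c + d = 0 then f else (k, c + d) :: f)
    else (l, d) :: ins k c f

theorem ev_ins (k : ℕ) (c : ℚ) (f : Form) : ev G (ins k c f) = c • G k + ev G f := by
  induction f with
  | nil => by_cases hc : c = 0 <;> simp [ins, hc]
  | cons p f ih =>
    obtain ⟨l, d⟩ := p
    rw [ins]
    split_ifs with h1 h2 h3 h4
    · simp [h2]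
    · simp
    · subst h3
      rw [ev_cons, ← add_assoc, ← add_smul, h4]
      simp
    · subst h3
      rw [ev_cons, ev_cons, ← add_assoc, ← add_smul]
    · rw [ev_cons, ev_cons, ih]
      abel

/-- `axpy q f f'` is `q • f + f'`. -/
def axpy (q : ℚ) (f f' : Form) : Form :=
  f.foldr (fun p acc => ins p.1 (q * p.2) acc) f'

theorem ev_axpy (q : ℚ) (f f' : Form) : ev G (axpy q f f') = q • ev G f + ev G f' := by
  induction f with
  | nil => simp [axpy]
  | cons p f ih =>
    have : axpy q (p :: f) f' = ins p.1 (q * p.2) (axpy q f f') := rfl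
    rw [this, ev_ins, ih, ev_cons, smul_add, mul_smul, add_assoc]

/-- Replace the `k`-th generator by the form `σ k`. -/
def subst (σ : ℕ → Form) (f : Form) : Form :=
  f.foldr (fun p acc => axpy p.2 (σ p.1) acc) []

theorem ev_subst (σ : ℕ → Form) (f : Form) : ev G (subst σ f) = ev (fun k => ev G (σ k)) f := by
  induction f with
  | nil => simp [subst]
  | cons p f ih =>
    have : subst σ (p :: f) = axpy p.2 (σ p.1) (subst σ f) := rfl
    rw [this, ev_axpy, ih, ev_cons]

/-- The coefficient of the `k`-th generator. -/
def coef (k : ℕ) : Form → ℚ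
  | [] => 0
  | (l, d) :: f => if k < l then 0 else if k = l then d else coef k f

/-- Subtract from the second form the multiple of the first one that removes the leading
generator of the first one. -/
def elim : Form → Form → Form
  | [], v => v
  | (k, c) :: b, v => if coef k v = 0 then v else axpy (-coef k v / c) ((k, c) :: b) v

theorem ev_elim_mem_iff {W : Submodule ℚ M} {b : Form} (hb : ev G b ∈ W) (v : Form) :
    ev G (elim b v) ∈ W ↔ ev G v ∈ W := by
  match b with
  | [] => rfl
  | (k, c) :: b =>
    rw [elim]
    split_ifs
    · rfl
    · rw [ev_axpy]
      exact W.add_mem_iff_right (W.smul_mem _ hb)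

/-- Reduce a form modulo a list of forms in echelon shape. -/
def reduce : List Form → Form → Form
  | [], v => v
  | b :: B, v => reduce B (elim b v)

/-- Reduction only adds multiples of forms whose values lie in `W`. Soundness therefore needs
neither sorted forms nor an echelon shape; these matter only for the computation to succeed. -/
theorem ev_reduce_mem_iff {W : Submodule ℚ M} {B : List Form} (hB : ∀ b ∈ B, ev G b ∈ W)
    (v : Form) : ev G (reduce B v) ∈ W ↔ ev G v ∈ W := by
  induction B generalizing v with
  | nil => rfl
  | cons b B ih =>
    rw [reduce, ih fun c hc => hB c (by simp [hc]), ev_elim_mem_iff G (hB b (by simp))]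

/-- Put a list of forms into echelon shape. -/
def echelon : List Form → List Form → List Form
  | B, [] => B
  | B, v :: q => echelon (B ++ [reduce B v]) q

theorem ev_echelon_mem {W : Submodule ℚ M} {B q : List Form} (hB : ∀ b ∈ B, ev G b ∈ W)
    (hq : ∀ v ∈ q, ev G v ∈ W) : ∀ b ∈ echelon B q, ev G b ∈ W := by
  induction q generalizing B with
  | nil => exact hB
  | cons v q ih =>
    refine ih (fun b hb => ?_) fun w hw => hq w (by simp [hw])
    rcases List.mem_append.mp hb with hb | hb
    · exact hB b hb
    · rw [List.mem_singleton.mp hb, ev_reduce_mem_iff G hB]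
      exact hq v (by simp)

/-- The four images of a form under the substitutions `σ s t`. -/
def images (σ : Fin 2 → Fin 2 → ℕ → Form) (f : Form) : List Form :=
  [subst (σ 0 0) f, subst (σ 0 1) f, subst (σ 1 0) f, subst (σ 1 1) f]

/-- Check that the forms in the list `q` lie, together with those in `B`, in a space stable under
the substitutions `σ` on which the functional with values `e` on the generators vanishes. The
forms in `B` are those already treated; the number of steps is bounded by the first argument. -/
def closes (σ : Fin 2 → Fin 2 → ℕ → Form) (e : ℕ → ℚ) : ℕ → List Form → List Form → Bool
  | 0, _, _ => false
  | _ + 1, _, [] => true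
  | n + 1, B, v :: q =>
    match reduce B v with
    | [] => closes σ e n B q
    | p :: r =>
      if ev e (p :: r) = 0 then closes σ e n (B ++ [p :: r]) (images σ (p :: r) ++ q) else false

/-- The space spanned by the values of a list of forms. -/
def evSpan (l : List Form) : Submodule ℚ M := Submodule.span ℚ (ev G '' {v | v ∈ l})

theorem ev_mem_evSpan {l : List Form} {v : Form} (hv : v ∈ l) : ev G v ∈ evSpan G l :=
  Submodule.subset_span ⟨v, hv, rfl⟩

theorem evSpan_le_iff {l : List Form} {W : Submodule ℚ M} :
    evSpan G l ≤ W ↔ ∀ v ∈ l, ev G v ∈ W := by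
  refine ⟨fun h v hv => h (ev_mem_evSpan G hv), fun h => Submodule.span_le.mpr ?_⟩
  rintro _ ⟨v, hv, rfl⟩
  exact h v hv

theorem ev_mem_of_reduce {W : Submodule ℚ M} {B : List Form} (hB : ∀ b ∈ B, ev G b ∈ W)
    {v : Form} (h : ev G (reduce B v) ∈ W) : ev G v ∈ W :=
  (ev_reduce_mem_iff G hB v).mp h

/-- Invariant of the search: values of treated forms are killed by `η`, and their images lie in the
span of treated and waiting forms. Once nothing waits, the span of the treated forms is stable.
Running out of steps returns `false`, so `true` is a certificate. -/
theorem exists_stable_of_closes {σ : Fin 2 → Fin 2 → ℕ → Form} {e : ℕ → ℚ}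
    (φ : Fin 2 → Fin 2 → M →ₗ[ℚ] M) (hφ : ∀ s t k, φ s t (G k) = ev G (σ s t k))
    {N : Type*} [AddCommGroup N] [Module ℚ N] (η : M →ₗ[ℚ] N) (x : N)
    (hη : ∀ k, η (G k) = e k • x) (n : ℕ) (B q : List Form)
    (hB : ∀ b ∈ B, η (ev G b) = 0 ∧ ∀ s t, φ s t (ev G b) ∈ evSpan G (B ++ q))
    (h : closes σ e n B q = true) :
    ∃ W : Submodule ℚ M, evSpan G (B ++ q) ≤ W ∧ ∀ y ∈ W, η y = 0 ∧ ∀ s t, φ s t y ∈ W := by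
  have hφ' : ∀ s t f, φ s t (ev G f) = ev G (subst (σ s t) f) := fun s t f => by
    rw [map_ev, ev_subst]
    simp_rw [hφ]
  have hη' : ∀ f, η (ev G f) = ev e f • x := fun f => by
    induction f with
    | nil => simp
    | cons p f ih => simp [ih, hη, add_smul, mul_smul]
  induction n generalizing B q with
  | zero => simp [closes] at h
  | succ n ih =>
    match q with
    | [] =>
      rw [List.append_nil] at hB ⊢
      refine ⟨evSpan G B, le_rfl, fun y hy => ?_⟩
      induction hy using Submodule.span_induction with
      | mem y hy =>
        obtain ⟨b, hb, rfl⟩ := hy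
        exact hB b hb
      | zero => simp
      | add y z _ _ hy hz =>
        exact ⟨by rw [map_add, hy.1, hz.1, add_zero], fun s t => by
          rw [map_add]; exact Submodule.add_mem _ (hy.2 s t) (hz.2 s t)⟩
      | smul c y _ hy =>
        exact ⟨by rw [map_smul, hy.1, smul_zero], fun s t => by
          rw [map_smul]; exact Submodule.smul_mem _ _ (hy.2 s t)⟩
    | v :: q =>
      rw [closes] at h
      split at h
      · rename_i hr
        -- A form that reduces to zero modulo `B` can be dropped without shrinking the span.
        have hsub : evSpan G (B ++ v :: q) ≤ evSpan G (B ++ q) := by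
          have hBq : ∀ b ∈ B ++ q, ev G b ∈ evSpan G (B ++ q) := fun b hb => ev_mem_evSpan G hb
          rw [evSpan_le_iff]
          intro b hb
          rcases List.mem_append.mp hb with hb | hb
          · exact hBq b (List.mem_append_left _ hb)
          · rcases List.mem_cons.mp hb with rfl | hb
            · refine ev_mem_of_reduce G (fun c hc => hBq c (List.mem_append_left _ hc)) ?_
              rw [hr]
              exact Submodule.zero_mem _
            · exact hBq b (List.mem_append_right _ hb)
        obtain ⟨W, hW, hW'⟩ := ih B q
          (fun b hb => ⟨(hB b hb).1, fun s t => hsub ((hB b hb).2 s t)⟩) h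
        exact ⟨W, hsub.trans hW, hW'⟩
      · rename_i p r hr
        split_ifs at h with he
        -- The form `v` is recovered from its remainder and `B`, so replacing it by the remainder
        -- loses nothing.
        have hsub : evSpan G (B ++ v :: q) ≤
            evSpan G ((B ++ [p :: r]) ++ (images σ (p :: r) ++ q)) := by
          rw [evSpan_le_iff]
          intro b hb
          rcases List.mem_append.mp hb with hb | hb
          · exact ev_mem_evSpan G (by simp [hb])
          · rcases List.mem_cons.mp hb with rfl | hb
            · refine ev_mem_of_reduce G (B := B) (fun c hc => ev_mem_evSpan G (by simp [hc])) ?_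
              rw [hr]
              exact ev_mem_evSpan G (by simp)
            · exact ev_mem_evSpan G (by simp [hb])
        obtain ⟨W, hW, hW'⟩ := ih (B ++ [p :: r]) (images σ (p :: r) ++ q) (fun b hb => by
          rcases List.mem_append.mp hb with hb | hb
          · exact ⟨(hB b hb).1, fun s t => hsub ((hB b hb).2 s t)⟩
          · rw [List.mem_singleton.mp hb]
            refine ⟨by rw [hη', he, zero_smul], fun s t => ?_⟩
            rw [hφ']
            refine ev_mem_evSpan G ?_
            fin_cases s <;> fin_cases t <;> simp [images]) h
        exact ⟨W, hsub.trans hW, hW'⟩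

end Form

/-! ### Corners of sequences of matrices -/

theorem half_val {n : ℕ} (s : Fin 2) (i : Fin (2 ^ n)) : (half s i : ℕ) = s * 2 ^ n + i := rfl

/-- The position of a row or column within its half. -/
def low {n : ℕ} (i : Fin (2 ^ (n + 1))) : Fin (2 ^ n) :=
  ⟨i % 2 ^ n, Nat.mod_lt _ (by positivity)⟩

/-- The half a row or column belongs to. -/
def high {n : ℕ} (i : Fin (2 ^ (n + 1))) : Fin 2 :=
  ⟨i / 2 ^ n, Nat.div_lt_of_lt_mul (by rw [← pow_succ]; exact i.isLt)⟩

@[simp] theorem low_half {n : ℕ} (s : Fin 2) (i : Fin (2 ^ n)) : low (half s i) = i := by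
  ext
  simp [low, half_val, Nat.mod_eq_of_lt i.isLt]

@[simp] theorem high_half {n : ℕ} (s : Fin 2) (i : Fin (2 ^ n)) : high (half s i) = s := by
  ext
  have h : 0 < 2 ^ n := by positivity
  simp only [high, half_val]
  rw [mul_comm, Nat.mul_add_div h, Nat.div_eq_of_lt i.isLt, add_zero]

@[simp] theorem half_high_low {n : ℕ} (i : Fin (2 ^ (n + 1))) : half (high i) (low i) = i := by
  ext
  simp only [high, low, half_val]
  rw [mul_comm]
  exact Nat.div_add_mod _ _

/-- Rows and columns of a matrix of size `2^(n+1)`, by their half and position. -/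
def halfEquiv (n : ℕ) : Fin 2 × Fin (2 ^ n) ≃ Fin (2 ^ (n + 1)) where
  toFun p := half p.1 p.2
  invFun i := (high i, low i)
  left_inv p := by simp
  right_inv i := by simp

@[simp] theorem shift_apply (s t : Fin 2) (A : MatSeq) (n : ℕ) (i j : Fin (2 ^ n)) :
    shift s t A n i j = A (n + 1) (half s i) (half t j) := rfl

/-- The entry of the `1 × 1` matrix of a sequence. -/
def corner : MatSeq →ₗ[ℂ] ℂ where
  toFun A := A 0 0 0
  map_add' _ _ := rfl
  map_smul' _ _ := rfl

theorem corner_apply (A : MatSeq) : corner A = A 0 0 0 := rfl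

theorem fin_pow_zero (i : Fin (2 ^ 0)) : i = 0 := by
  ext
  simp

/-- Each entry of `A n` is the `1 × 1` entry of an `n`-fold corner of `A`, and that corner stays in
`W`. -/
theorem eq_zero_of_stable {W : Submodule ℚ MatSeq}
    (hW : ∀ A ∈ W, corner A = 0 ∧ ∀ s t, shift s t A ∈ W) {A : MatSeq} (hA : A ∈ W) : A = 0 := by
  funext n
  induction n generalizing A with
  | zero =>
    ext i j
    rw [fin_pow_zero i, fin_pow_zero j]
    exact (hW A hA).1
  | succ n ih =>
    ext i j
    have := congrFun (congrFun (ih ((hW A hA).2 (high i) (high j))) (low i)) (low j)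
    simpa using this

/-- Multiplication of `2 × 2` block matrices. -/
theorem shift_mul (s t : Fin 2) (A B : MatSeq) :
    shift s t (A * B) = shift s 0 A * shift 0 t B + shift s 1 A * shift 1 t B := by
  funext n
  ext i j
  have h : shift s t (A * B) n i j =
      ∑ k, A (n + 1) (half s i) k * B (n + 1) k (half t j) := rfl
  rw [h, ← (halfEquiv n).sum_comp, Fintype.sum_prod_type, Fin.sum_univ_two]
  rfl

theorem shift_transposeSeq (s t : Fin 2) (A : MatSeq) :
    shift s t (transposeSeq A) = transposeSeq (shift t s A) := rfl

theorem corner_mul (A B : MatSeq) : corner (A * B) = corner A * corner B := by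
  have h : corner (A * B) = ∑ k, A 0 0 k * B 0 k 0 := rfl
  rw [h, Fintype.sum_eq_single 0 fun k hk => (hk (fin_pow_zero k)).elim]
  rfl

theorem corner_transposeSeq (A : MatSeq) : corner (transposeSeq A) = corner A := rfl

/-! ### Automata and complexity -/

/-- The matrices of size `2^n` of the states of the automaton with transitions `T` and initial
values `e`. -/
noncomputable def automatonMatrix (T : Fin 2 → Fin 2 → ℕ → Form) (e : ℕ → ℚ) :
    (n : ℕ) → ℕ → Matrix (Fin (2 ^ n)) (Fin (2 ^ n)) ℂ
  | 0, a => Matrix.of fun _ _ => (e a : ℂ)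
  | n + 1, a => Matrix.of fun i j =>
    Form.ev (fun b => automatonMatrix T e n b (low i) (low j)) (T (high i) (high j) a)

/-- The states of the automaton with transitions `T` and initial values `e`. -/
noncomputable def automaton (T : Fin 2 → Fin 2 → ℕ → Form) (e : ℕ → ℚ) (a : ℕ) : MatSeq :=
  fun n => automatonMatrix T e n a

/-- The linear map reading off an entry. -/
def entry (n : ℕ) (i j : Fin (2 ^ n)) : MatSeq →ₗ[ℂ] ℂ where
  toFun A := A n i j
  map_add' _ _ := rfl
  map_smul' _ _ := rfl

theorem ev_apply (X : ℕ → MatSeq) (f : Form) (n : ℕ) (i j : Fin (2 ^ n)) :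
    Form.ev X f n i j = Form.ev (fun a => X a n i j) f :=
  Form.map_ev X ((entry n i j).restrictScalars ℚ) f

theorem shift_automaton (T : Fin 2 → Fin 2 → ℕ → Form) (e : ℕ → ℚ) (s t : Fin 2) (a : ℕ) :
    shift s t (automaton T e a) = Form.ev (automaton T e) (T s t a) := by
  funext n
  ext i j
  rw [ev_apply, shift_apply]
  simp [automaton, automatonMatrix]

theorem corner_automaton (T : Fin 2 → Fin 2 → ℕ → Form) (e : ℕ → ℚ) (a : ℕ) :
    corner (automaton T e a) = e a := rfl

/-- The entry reached by taking the given corners one after the other. -/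
def read : List (Fin 2 × Fin 2) → MatSeq →ₗ[ℂ] ℂ
  | [] => corner
  | p :: w => read w ∘ₗ shift p.1 p.2

/-- The entry of the `a`-th state of an automaton that is reached by taking the given corners. -/
def readState (T : Fin 2 → Fin 2 → ℕ → Form) (e : ℕ → ℚ) : List (Fin 2 × Fin 2) → ℕ → ℚ
  | [], a => e a
  | p :: w, a => Form.ev (readState T e w) (T p.1 p.2 a)

/-- `X` lists the states of the automaton with transitions `T` and initial values `e`. -/
structure IsAutomaton (T : Fin 2 → Fin 2 → ℕ → Form) (e : ℕ → ℚ) (X : ℕ → MatSeq) : Prop where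
  shift_eq : ∀ s t a, shift s t (X a) = Form.ev X (T s t a)
  corner_eq : ∀ a, corner (X a) = e a

theorem isAutomaton_automaton (T : Fin 2 → Fin 2 → ℕ → Form) (e : ℕ → ℚ) :
    IsAutomaton T e (automaton T e) :=
  ⟨shift_automaton T e, corner_automaton T e⟩

theorem ev_ratCast (x : ℕ → ℚ) (f : Form) :
    Form.ev (fun a => (x a : ℂ)) f = ((Form.ev x f : ℚ) : ℂ) := by
  induction f with
  | nil => simp
  | cons p f ih => simp [ih, Rat.smul_def]

theorem ev_map_range {M : Type*} [AddCommGroup M] [Module ℚ M] (G : ℕ → M) (c : ℕ → ℚ) (N : ℕ) :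
    Form.ev G ((List.range N).map fun a => (a, c a)) = ∑ a ∈ Finset.range N, c a • G a := by
  induction N with
  | zero => simp
  | succ N ih => simp [List.range_succ, Form.ev_append, ih, Finset.sum_range_succ]

namespace IsAutomaton

variable {T : Fin 2 → Fin 2 → ℕ → Form} {e : ℕ → ℚ} {X : ℕ → MatSeq}

theorem read_eq (h : IsAutomaton T e X) (w : List (Fin 2 × Fin 2)) (a : ℕ) :
    read w (X a) = readState T e w a := by
  induction w generalizing a with
  | nil => exact h.corner_eq a
  | cons p w ih =>
    have h1 : read (p :: w) (X a) = (read w).restrictScalars ℚ (shift p.1 p.2 (X a)) := rfl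
    rw [h1, h.shift_eq, Form.map_ev]
    simp only [LinearMap.coe_restrictScalars, ih]
    exact ev_ratCast _ _

/-- The entries of the first `N` states reached by taking the given corners. -/
def readForm (T : Fin 2 → Fin 2 → ℕ → Form) (e : ℕ → ℚ) (N : ℕ) (w : List (Fin 2 × Fin 2)) :
    Form :=
  Form.axpy 1 ((List.range N).map fun a => (a, readState T e w a)) []

/-- Check that the entries given by `ws` separate the first `N` states. -/
def separates (T : Fin 2 → Fin 2 → ℕ → Form) (e : ℕ → ℚ) (N : ℕ)
    (ws : List (List (Fin 2 × Fin 2))) : Bool :=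
  (List.range N).all fun a =>
    (Form.reduce (Form.echelon [] (ws.map (readForm T e N))) [(a, 1)]).isEmpty

/-- Reading one entry of a linear relation gives an equation with rational coefficients for its
complex coefficients. The check says that these equations imply that each coefficient vanishes. -/
theorem linearIndependent (h : IsAutomaton T e X) {N : ℕ} {ws : List (List (Fin 2 × Fin 2))}
    (hws : separates T e N ws = true) : LinearIndependent ℂ fun a : Fin N => X a := by
  rw [Fintype.linearIndependent_iff]
  intro g hg
  set l : ℕ → ℂ := fun k => if hk : k < N then g ⟨k, hk⟩ else 0 with hl
  have hrow : ∀ w, Form.ev l (readForm T e N w) = 0 := by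
    intro w
    have h0 := congrArg (read w) hg
    rw [map_sum, map_zero] at h0
    rw [readForm, Form.ev_axpy, one_smul, Form.ev_nil, add_zero, ev_map_range, Finset.sum_range,
      ← h0]
    refine Finset.sum_congr rfl fun a _ => ?_
    rw [map_smul, h.read_eq, Rat.smul_def, smul_eq_mul, mul_comm]
    simp [hl]
  -- The coefficients are taken as values of the generators in the `ℚ`-space `ℂ`. With `W = ⊥`,
  -- membership means that the equation holds.
  have hech : ∀ b ∈ Form.echelon [] (ws.map (readForm T e N)),
      Form.ev l b ∈ (⊥ : Submodule ℚ ℂ) := by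
    refine Form.ev_echelon_mem l (by simp) fun v hv => ?_
    obtain ⟨w, -, rfl⟩ := List.mem_map.mp hv
    exact hrow w
  intro a
  have ha := List.all_eq_true.mp hws a (List.mem_range.mpr a.isLt)
  rw [List.isEmpty_iff] at ha
  have := Form.ev_mem_of_reduce l hech (v := [((a : ℕ), 1)]) (by rw [ha]; simp)
  simpa [hl] using this

/-- The span of the states is recursively closed. Conversely, by `hreach` every state is a corner of
an earlier one, hence lies in every closed space containing `X 0`. -/
theorem complexity_eq (h : IsAutomaton T e X) {N : ℕ} (hN : 0 < N)
    (hT : ∀ a < N, ∀ s t, ∀ p ∈ T s t a, p.1 < N)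
    (hreach : ∀ a < N, a ≠ 0 → ∃ b < a, ∃ s t, T s t b = [(a, 1)])
    {ws : List (List (Fin 2 × Fin 2))} (hws : separates T e N ws = true) :
    complexity (X 0) = N := by
  have hspan : recClosure (X 0) = Submodule.span ℂ (Set.range fun a : Fin N => X a) := by
    apply le_antisymm
    · refine sInf_le ⟨fun s t A hA => ?_, Submodule.subset_span ⟨⟨0, hN⟩, rfl⟩⟩
      induction hA using Submodule.span_induction with
      | mem A hA =>
        obtain ⟨a, rfl⟩ := hA
        rw [h.shift_eq]
        exact Form.ev_mem X
          (W := (Submodule.span ℂ (Set.range fun a : Fin N => X a)).restrictScalars ℚ)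
          fun p hp => Submodule.subset_span ⟨⟨p.1, hT a a.isLt s t p hp⟩, rfl⟩
      | zero => simp
      | add A B _ _ hA hB => rw [map_add]; exact Submodule.add_mem _ hA hB
      | smul c A _ hA => rw [map_smul]; exact Submodule.smul_mem _ _ hA
    · rw [Submodule.span_le]
      rintro _ ⟨a, rfl⟩
      obtain ⟨a, ha⟩ := a
      simp only [SetLike.mem_coe, recClosure, Submodule.mem_sInf]
      rintro V ⟨hV, h0⟩
      induction a using Nat.strong_induction_on with
      | _ a ih =>
        by_cases ha0 : a = 0
        · exact ha0 ▸ h0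
        · obtain ⟨b, hb, s, t, hst⟩ := hreach a ha ha0
          have := hV s t _ (ih b hb (hb.trans ha))
          rw [h.shift_eq, hst] at this
          simpa using this
  rw [complexity, hspan, rank_span (h.linearIndependent hws),
    Cardinal.mk_range_eq _ (h.linearIndependent hws).injective]
  simp

end IsAutomaton

/-! ### Binomial coefficients modulo 8 -/

/-- Kummer's theorem: the exponent of `2` in the binomial coefficient is the number of carries when
adding `s` and `t` in base `2`. -/
theorem not_even_choose_iff (s t : ℕ) :
    ¬ 2 ∣ (s + t).choose s ↔ ∀ i, 1 ≤ i → s % 2 ^ i + t % 2 ^ i < 2 ^ i := by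
  have : Fact (Nat.Prime 2) := ⟨Nat.prime_two⟩
  have hpos : (t + s).choose s ≠ 0 := (Nat.choose_pos (by omega)).ne'
  rw [add_comm s t, ← not_iff_not, not_not,
    dvd_iff_padicValNat_ne_zero hpos, padicValNat_choose' (Nat.lt_succ_self _),
    Ne, Finset.card_eq_zero, Finset.filter_eq_empty_iff]
  push Not
  constructor
  · rintro ⟨i, hi, h⟩
    exact ⟨i, (Finset.mem_Ico.mp hi).1, h⟩
  · rintro ⟨i, hi, h⟩
    refine ⟨i, Finset.mem_Ico.mpr ⟨hi, Nat.lt_succ_of_le ?_⟩, h⟩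
    refine (Nat.le_log_iff_pow_le one_lt_two ?_).mpr ?_
    · rintro h0
      have hs : s = 0 := by omega
      have ht : t = 0 := by omega
      have := Nat.one_le_two_pow (n := i)
      simp [hs, ht] at h
    · have := Nat.mod_le s (2 ^ i)
      have := Nat.mod_le t (2 ^ i)
      omega

theorem χ₈_natCast_eq_zero_iff (m : ℕ) : ZMod.χ₈ (m : ZMod 8) = 0 ↔ 2 ∣ m := by
  rw [ZMod.χ₈_nat_eq_if_mod_eight]
  split_ifs <;> simp <;> omega

theorem pascalJ_comm (s t : ℕ) : pascalJ s t = pascalJ t s := by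
  simp only [pascalJ, Matrix.of_apply]
  rw [Nat.choose_symm_add, add_comm s t]

theorem pascalJ_eq_zero_of_carry {s t : ℕ} (i : ℕ) (hi : 1 ≤ i)
    (h : 2 ^ i ≤ s % 2 ^ i + t % 2 ^ i) : pascalJ s t = 0 := by
  refine (χ₈_natCast_eq_zero_iff _).mpr ?_
  by_contra hd
  exact absurd ((not_even_choose_iff s t).mp hd i hi) (by omega)

theorem pascalJ_top_top {n s t : ℕ} (hs : s < 2 ^ n) (ht : t < 2 ^ n) :
    pascalJ (2 ^ n + s) (2 ^ n + t) = 0 := by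
  refine pascalJ_eq_zero_of_carry (n + 1) (by omega) ?_
  rw [Nat.mod_eq_of_lt (by rw [pow_succ]; omega), Nat.mod_eq_of_lt (by rw [pow_succ]; omega),
    pow_succ]
  omega

/-- The value of `χ_J` on the odd part. -/
def oddJacobi (m : ℕ) : ℤ := ZMod.χ₈ ((ordCompl[2] m : ℕ) : ZMod 8)

theorem oddJacobi_mul (a b : ℕ) : oddJacobi (a * b) = oddJacobi a * oddJacobi b := by
  rw [oddJacobi, Nat.ordCompl_mul, Nat.cast_mul, map_mul]; rfl

theorem oddJacobi_two_pow_mul (v : ℕ) {u : ℕ} (hu : ¬ 2 ∣ u) :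
    oddJacobi (2 ^ v * u) = ZMod.χ₈ (u : ZMod 8) := by
  rw [oddJacobi, Nat.ordCompl_pow_mul_of_not_dvd v Nat.prime_two hu]

theorem oddJacobi_ne_zero {m : ℕ} (hm : m ≠ 0) : oddJacobi m ≠ 0 := by
  rw [oddJacobi, Ne, χ₈_natCast_eq_zero_iff]
  exact Nat.not_dvd_ordCompl Nat.prime_two hm

/-- Write `x = 2 ^ v * u` with `u` odd. For `v < n` the odd part is unchanged modulo `8`, and for `v
= n` it grows by `4`, which flips the sign. The bound on `x` leaves only `v = n + 1`, `u = 1`, where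
the odd part passes from `1` to `3`. -/
theorem oddJacobi_add {n x : ℕ} (hx : x ≠ 0) (hxn : x < 4 * 2 ^ n) :
    oddJacobi (x + 4 * 2 ^ n) = (if 2 ^ n ∣ x then -1 else 1) * oddJacobi x := by
  obtain ⟨v, u, hu, rfl⟩ := Nat.exists_eq_two_pow_mul_odd hx
  have hu' : ¬ 2 ∣ u := hu.not_two_dvd_nat
  have hu0 : 1 ≤ u := hu.pos
  have hv : v < n + 2 := by
    have h1 : 2 ^ v < 2 ^ (n + 2) := by
      rw [pow_add]
      nlinarith [Nat.le_mul_of_pos_right (2 ^ v) hu0]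
    exact (Nat.pow_lt_pow_iff_right one_lt_two).mp h1
  obtain ⟨d, rfl | hd⟩ : ∃ d, n = v + d ∨ v = n + 1 := by
    rcases Nat.lt_or_ge n v with h | h
    · exact ⟨0, Or.inr (by omega)⟩
    · exact ⟨n - v, Or.inl (by omega)⟩
  · have h1 : 2 ^ v * u + 4 * 2 ^ (v + d) = 2 ^ v * (u + 4 * 2 ^ d) := by ring
    have hdvd : 2 ^ (v + d) ∣ 2 ^ v * u ↔ d = 0 := by
      rw [pow_add, Nat.mul_dvd_mul_iff_left (by positivity)]
      constructor
      · intro h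
        by_contra h0
        exact hu' ((dvd_pow_self 2 h0).trans h)
      · rintro rfl; simp
    rw [h1, oddJacobi_two_pow_mul v hu', oddJacobi_two_pow_mul v (by omega)]
    simp only [hdvd, ZMod.χ₈_nat_eq_if_mod_eight]
    rcases d with _ | d
    · split_ifs <;> omega
    · have h2 : (u + 4 * 2 ^ (d + 1)) % 8 = u % 8 := by rw [pow_succ]; omega
      have h3 : (u + 4 * 2 ^ (d + 1)) % 2 = u % 2 := by omega
      rw [h2, h3]
      simp
  · subst hd
    have hu1 : u = 1 := by
      by_contra h
      have : 3 ≤ u := by omega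
      rw [pow_succ] at hxn
      nlinarith [Nat.one_le_two_pow (n := n)]
    subst hu1
    have h1 : 2 ^ (n + 1) * 1 + 4 * 2 ^ n = 2 ^ (n + 1) * 3 := by ring
    rw [h1, oddJacobi_two_pow_mul _ (by norm_num), oddJacobi_two_pow_mul _ (by norm_num),
      if_pos (by rw [pow_succ]; exact ⟨2, by ring⟩)]
    decide

/-- By `oddJacobi_add`, one sign arises for each multiple of `2 ^ n` among `t + 1, …, t + s`. Their
number has the parity of the exponent. -/
theorem oddJacobi_ascFactorial {n t : ℕ} (s : ℕ) (h : s + t < 4 * 2 ^ n) :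
    oddJacobi ((t + 4 * 2 ^ n + 1).ascFactorial s) =
      (-1) ^ ((s + t) / 2 ^ n + t / 2 ^ n) * oddJacobi ((t + 1).ascFactorial s) := by
  induction s with
  | zero =>
    rw [zero_add, ← two_mul, pow_mul]
    simp
  | succ s ih =>
    have h1 : t + 4 * 2 ^ n + 1 + s = (s + 1 + t) + 4 * 2 ^ n := by ring
    have h2 : t + 1 + s = s + 1 + t := by ring
    have h3 : s + 1 + t = s + t + 1 := by ring
    rw [Nat.ascFactorial_succ, Nat.ascFactorial_succ, oddJacobi_mul, oddJacobi_mul, h1,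
      oddJacobi_add (by omega) h, ih (by omega), h2, h3, Nat.succ_div]
    split_ifs <;> ring

/-- A carry in `s + t` persists after adding `4 * 2 ^ n`, so both sides vanish together. Without
carries both binomial coefficients are odd. They are compared after multiplication by `s!`, which
gives rising factorials with possibly even factors; hence the passage to odd parts. -/
theorem pascalJ_add {n s t : ℕ} (hs : s < 4 * 2 ^ n) (ht : t < 4 * 2 ^ n) :
    pascalJ s (t + 4 * 2 ^ n) = (-1) ^ (s / 2 ^ n) * pascalJ s t := by
  have h4 : 4 * 2 ^ n = 2 ^ (n + 2) := by ring
  by_cases hst : s + t < 4 * 2 ^ n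
  · by_cases hd : 2 ∣ (s + t).choose s
    · have h0 : pascalJ s t = 0 := (χ₈_natCast_eq_zero_iff _).mpr hd
      rw [← not_not (a := 2 ∣ _), not_even_choose_iff] at hd
      push Not at hd
      obtain ⟨i, hi, hc⟩ := hd
      have hin : i ≤ n + 2 := by
        by_contra h
        have h1 := Nat.pow_le_pow_right two_pos (by omega : n + 2 ≤ i)
        rw [Nat.mod_eq_of_lt (by omega), Nat.mod_eq_of_lt (by omega)] at hc
        omega
      rw [h0, mul_zero]
      refine pascalJ_eq_zero_of_carry i hi ?_
      obtain ⟨c, hc'⟩ := pow_dvd_pow 2 hin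
      rw [h4, hc', Nat.add_mul_mod_self_left]
      exact hc
    · have hcarry := (not_even_choose_iff s t).mp hd
      have hn : s % 2 ^ n + t % 2 ^ n < 2 ^ n := by
        rcases Nat.eq_zero_or_pos n with rfl | h
        · simp [Nat.mod_one]
        · exact hcarry n h
      have hd' : ¬ 2 ∣ (s + (t + 4 * 2 ^ n)).choose s := by
        rw [not_even_choose_iff]
        intro i hi
        rcases Nat.lt_or_ge (n + 2) i with h | h
        · have h1 := Nat.pow_le_pow_right two_pos (by omega : n + 3 ≤ i)
          have h2 : 2 ^ (n + 3) = 8 * 2 ^ n := by ring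
          rw [Nat.mod_eq_of_lt (by omega), Nat.mod_eq_of_lt (by omega)]
          omega
        · obtain ⟨c, hc⟩ := pow_dvd_pow 2 h
          rw [h4, hc, Nat.add_mul_mod_self_left]
          exact hcarry i hi
      have hψ : ∀ m : ℕ, ¬ 2 ∣ (s + m).choose s →
          pascalJ s m * oddJacobi s.factorial = oddJacobi ((m + 1).ascFactorial s) := by
        intro m hm
        have h1 : pascalJ s m = oddJacobi ((s + m).choose s) := by
          have := oddJacobi_two_pow_mul 0 hm
          rw [pow_zero, one_mul] at this
          rw [this]
          rfl
        rw [h1, ← oddJacobi_mul, Nat.ascFactorial_eq_factorial_mul_choose, mul_comm,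
          add_comm m s]
      -- As the last `n` digits do not carry, quotients add, and the sign exponent becomes `s / 2 ^
      -- n` up to an even number.
      have hdiv : (s + t) / 2 ^ n = s / 2 ^ n + t / 2 ^ n := by
        rw [Nat.add_div (by positivity), if_neg (by omega), add_zero]
      have hne := oddJacobi_ne_zero (Nat.factorial_ne_zero s)
      apply mul_right_cancel₀ hne
      rw [hψ _ hd', mul_assoc, hψ _ hd, oddJacobi_ascFactorial s hst, hdiv, add_assoc,
        pow_add, ← two_mul, pow_mul]
      simp
  · have hc : 2 ^ (n + 2) ≤ s % 2 ^ (n + 2) + t % 2 ^ (n + 2) := by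
      rw [← h4, Nat.mod_eq_of_lt hs, Nat.mod_eq_of_lt ht]
      omega
    rw [pascalJ_eq_zero_of_carry (n + 2) (by omega) hc, mul_zero]
    refine pascalJ_eq_zero_of_carry (n + 2) (by omega) ?_
    rw [h4, Nat.add_mod_right]
    exact hc

/-! ### The numbers `g n` -/

theorem e_add_eight_mul (k m : ℕ) : e (k + 8 * m) = e k := by
  have : Fin.ofNat 8 (k + 8 * m) = Fin.ofNat 8 k := by
    ext; simp [Fin.ofNat]
  rw [e, this, e]

/-- The product of powers of `3` in `g n`. -/
noncomputable def gAbs (n : ℕ) : ℚ := ∏ᶠ k : ℕ, (3 : ℚ) ^ e (n / 2 ^ k)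

theorem gAbs_eq_prod {n m : ℕ} (h : n ≤ m) :
    gAbs n = ∏ k ∈ Finset.range m, (3 : ℚ) ^ e (n / 2 ^ k) := by
  refine finprod_eq_prod_of_mulSupport_subset _ fun k hk => ?_
  by_contra hkm
  simp only [Finset.coe_range, Set.mem_Iio, not_lt] at hkm
  apply hk
  have : n / 2 ^ k = 0 := Nat.div_eq_of_lt ((h.trans hkm).trans_lt Nat.lt_two_pow_self)
  simp [this, e]

theorem gAbs_zero : gAbs 0 = 1 := by
  rw [gAbs_eq_prod le_rfl]; simp

theorem gAbs_eq (n : ℕ) : gAbs n = 3 ^ e n * gAbs (n / 2) := by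
  rw [gAbs_eq_prod (Nat.le_succ n), Finset.prod_range_succ', gAbs_eq_prod (Nat.div_le_self n 2),
    mul_comm]
  congr 1
  · simp
  · refine Finset.prod_congr rfl fun k _ => ?_
    rw [Nat.div_div_eq_div_mul, pow_succ, mul_comm 2]

/-- Passing to `k / 2` lowers `n` by one and leaves the leading digits alone, while the factor `3 ^
e k` is unaffected because `e` has period `8`. -/
theorem g_add {n k : ℕ} (hk : k < 4 * 2 ^ n) :
    g (k + 4 * 2 ^ n) = (if Even (k / 2 ^ n) then 3 else 1 / 3) * g k := by
  have key : gAbs (k + 4 * 2 ^ n) = (if Even (k / 2 ^ n) then 3 else 1 / 3) * gAbs k := by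
    induction n generalizing k with
    | zero =>
      -- The induction ends in comparing `gAbs k` with `gAbs (k + 4)` for `k < 4`; here the chosen
      -- values of `e` enter.
      have h1 := gAbs_eq 1
      have h2 := gAbs_eq 2
      have h3 := gAbs_eq 3
      have h4 := gAbs_eq 4
      have h5 := gAbs_eq 5
      have h6 := gAbs_eq 6
      have h7 := gAbs_eq 7
      rw [show e 1 = 0 from rfl] at h1
      rw [show e 2 = 1 from rfl] at h2
      rw [show e 3 = -1 from rfl] at h3
      rw [show e 4 = 0 from rfl] at h4
      rw [show e 5 = -2 from rfl] at h5
      rw [show e 6 = 3 from rfl] at h6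
      rw [show e 7 = -1 from rfl] at h7
      norm_num [gAbs_zero] at h1 h2 h3 h4 h5 h6 h7
      have hk4 : k < 4 := by simpa using hk
      interval_cases k <;> norm_num [*, gAbs_zero, Nat.even_iff]
    | succ n ih =>
      have h1 : (k + 4 * 2 ^ (n + 1)) / 2 = k / 2 + 4 * 2 ^ n := by rw [pow_succ]; omega
      have h2 : k / 2 / 2 ^ n = k / 2 ^ (n + 1) := by
        rw [Nat.div_div_eq_div_mul, pow_succ, mul_comm]
      have h3 : k + 4 * 2 ^ (n + 1) = k + 8 * 2 ^ n := by ring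
      rw [gAbs_eq, h1, ih (by rw [pow_succ] at hk; omega), h2, gAbs_eq k, h3, e_add_eight_mul]
      ring
  have hg : ∀ m, g m = (-1) ^ m * gAbs m := fun m => rfl
  rw [hg, hg, key, pow_add, show 4 * 2 ^ n = 2 * (2 * 2 ^ n) by ring, pow_mul]
  norm_num
  ring_nf

/-! ### The automata of the three matrices -/

/-- The shifts of the states of the automaton for the lower triangular factor. -/
def lTable : List (List Form) :=
  [[[(0, 1)], [], [(1, 1)], [(2, 1)]],
    [[(3, 1)], [(4, 1)], [(5, 1)], [(6, 1)]],
    [[(7, 1)], [], [(8, 1)], [(9, 1)]],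
    [[(0, 1)], [(10, 1)], [(1, 1)], [(2, 1)]],
    [[(11, 1)], [(12, 1)], [], []],
    [[(3, 1)], [(13, 1)], [(5, 1)], [(6, 1)]],
    [[(7, 1), (11, -1)], [(14, 1)], [(8, 1)], [(9, 1)]],
    [[(0, 1)], [], [(1, 1/3)], [(2, 1)]],
    [[(3, 1)], [(4, 3)], [(5, 1/3)], [(6, 1)]],
    [[(7, 1)], [], [(8, 1/3)], [(9, 1)]],
    [[(15, 1)], [(12, 1)], [(16, 1)], [(17, 1)]],
    [[(18, 1)], [(4, 4)], [], []],
    [[(11, 2/3)], [(12, 2)], [], []],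
    [[(11, 1), (15, 1)], [(19, 1)], [(16, 1)], [(17, 1)]],
    [[(11, -2/3), (15, 1)], [(12, 1)], [(16, 1/3)], [(17, 1)]],
    [[(0, -2/3)], [(10, 2)], [(1, 2/3)], [(2, 2)]],
    [[(3, -2/3)], [(4, -4), (13, 2)], [(5, 2/3)], [(6, 2)]],
    [[(7, -2/3), (11, -2/3)], [(14, 2)], [(8, 2/3)], [(9, 2)]],
    [[(18, 2)], [(4, 8/3)], [], []],
    [[(11, 4/3), (15, -2/3)], [(12, -2), (19, 2)], [(16, 2/3)], [(17, 2)]]]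

/-- The shifts of the states of the automaton for the diagonal factor. -/
def dTable : List (List Form) :=
  [[[(0, 1)], [], [], [(1, 1)]],
    [[(2, 1)], [], [], [(3, 1)]],
    [[(0, 3)], [], [], [(1, 1/3)]],
    [[(2, 3)], [], [], [(3, 1/3)]]]

/-- The shifts of the states of the automaton for `J`. -/
def jTable : List (List Form) :=
  [[[(0, 1)], [(1, 1)], [(2, 1)], []],
    [[(3, 1)], [(4, 1)], [(5, 1)], []],
    [[(6, 1)], [(7, 1)], [(8, 1)], []],
    [[(0, 1)], [(1, 1)], [(2, -1)], []],
    [[(3, 1)], [(4, 1)], [(5, -1)], []],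
    [[(6, 1)], [(7, 1)], [(8, -1)], []],
    [[(0, 1)], [(1, -1)], [(2, 1)], []],
    [[(3, 1)], [(4, -1)], [(5, 1)], []],
    [[(6, 1)], [(7, -1)], [(8, 1)], []]]

/-- The corners of the states of the automaton for the lower triangular factor. -/
def lInit : List ℚ :=
  [1, 1, 1, 1, 2, 1, 1, 1, 1/3, 1, 2, 4/3, 4, 0, 2, -2/3, 2/3, 2, 8/3, -4]

/-- The corners of the states of the automaton for the diagonal factor. -/
def dInit : List ℚ := [1, -1, 3, -1/3]

/-- The corners of the states of the automaton for `J`. -/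
def jInit : List ℚ := [1, 1, 1, 1, 1, -1, 1, -1, 1]

/-- The transition given by a table. -/
def tableShift (T : List (List Form)) (s t : Fin 2) (a : ℕ) : Form :=
  (T.getD a []).getD (2 * s + t) []

/-- All states that occur in the table have a number below `N`. -/
def boundedBy (T : List (List Form)) (N : ℕ) : Bool :=
  T.all fun r => r.all fun f => f.all fun p => decide (p.1 < N)

theorem getD_mem_or_eq {α : Type*} (l : List α) (n : ℕ) (d : α) :
    l.getD n d ∈ l ∨ l.getD n d = d := by
  rcases Nat.lt_or_ge n l.length with h | h
  · left
    rw [List.getD_eq_getElem l d h]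
    exact List.getElem_mem h
  · exact Or.inr (List.getD_eq_default l d h)

theorem lt_of_mem_tableShift {T : List (List Form)} {N : ℕ} (hT : boundedBy T N = true)
    (s t : Fin 2) (a : ℕ) {p : ℕ × ℚ} (hp : p ∈ tableShift T s t a) : p.1 < N := by
  rw [tableShift] at hp
  rcases getD_mem_or_eq (T.getD a []) (2 * s + t) [] with h | h
  · rcases getD_mem_or_eq T a [] with h' | h'
    · simp only [boundedBy, List.all_eq_true, decide_eq_true_eq] at hT
      exact hT _ h' _ h p hp
    · rw [h'] at h
      simp at h
  · rw [h] at hp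
    simp at hp

/-- The sequence given by `J`. -/
noncomputable def jSeq : MatSeq := toSeq (pascalJ.map fun x : ℤ => (x : ℂ))

theorem toSeq_apply (M : Matrix ℕ ℕ ℂ) (n : ℕ) (i j : Fin (2 ^ n)) : toSeq M n i j = M i j := rfl

theorem shift_zero_zero_toSeq (M : Matrix ℕ ℕ ℂ) : shift 0 0 (toSeq M) = toSeq M := by
  funext n
  ext i j
  simp [toSeq_apply, half_val]

theorem jSeq_apply (n : ℕ) (i j : Fin (2 ^ n)) : jSeq n i j = (pascalJ i j : ℂ) := rfl

theorem shift_one_one_jSeq : shift 1 1 jSeq = 0 := by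
  funext n
  ext i j
  simp [jSeq_apply, half_val, pascalJ_top_top i.isLt j.isLt]

theorem shift_one_one_shift_zero_one_jSeq : shift 1 1 (shift 0 1 jSeq) = 0 := by
  funext n
  ext i j
  have hi := i.isLt
  have hj := j.isLt
  have : pascalJ (2 ^ n + i) (2 ^ (n + 1) + (2 ^ n + j)) = 0 := by
    refine pascalJ_eq_zero_of_carry (n + 1) (by omega) ?_
    rw [Nat.add_mod_left, Nat.mod_eq_of_lt (by rw [pow_succ]; omega),
      Nat.mod_eq_of_lt (by rw [pow_succ]; omega), pow_succ]
    omega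
  simp [jSeq_apply, half_val, this]

theorem transposeSeq_jSeq : transposeSeq jSeq = jSeq := by
  funext n
  ext i j
  change jSeq n j i = jSeq n i j
  rw [jSeq_apply, jSeq_apply, pascalJ_comm]

/-- The two leading binary digits are `a` and `s`, so the sign in `pascalJ_add` and the factor in
`g_add` depend only on the inner digit `s`. -/
theorem half_half_lt {n : ℕ} (s a : Fin 2) (i : Fin (2 ^ n)) :
    (half a (half s i) : ℕ) < 4 * 2 ^ n ∧ (half a (half s i) : ℕ) / 2 ^ n = 2 * a + s := by
  have hi := i.isLt
  have hs := s.isLt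
  have ha := a.isLt
  have h : (half a (half s i) : ℕ) = (2 * a + s) * 2 ^ n + i := by
    rw [half_val, half_val, pow_succ]; ring
  refine ⟨by rw [h]; nlinarith, ?_⟩
  rw [h, mul_comm, Nat.mul_add_div (by positivity), Nat.div_eq_of_lt hi, add_zero]

/-- This is `pascalJ_add` in terms of corners: the outer shift to the right half adds `4 * 2 ^ n` to
the column. It closes the automaton of `J`, as threefold corners return to twofold ones. -/
theorem shift_shift_shift_zero_one_jSeq (s t a b : Fin 2) :
    shift s t (shift a b (shift 0 1 jSeq)) = (-1 : ℚ) ^ (s : ℕ) • shift s t (shift a b jSeq) := by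
  funext n
  ext i j
  have hi := half_half_lt s a i
  have hj := half_half_lt t b j
  have h := pascalJ_add hi.1 hj.1
  rw [hi.2, pow_add (-1 : ℤ), pow_mul (-1 : ℤ), neg_one_sq, one_pow, one_mul] at h
  have h4 : (half 1 (half b (half t j)) : ℕ) = half b (half t j) + 4 * 2 ^ n := by
    rw [half_val 1]; simp only [Fin.val_one]; ring
  have h0 : (half 0 (half a (half s i)) : ℕ) = half a (half s i) := by
    rw [half_val 0]; simp
  change jSeq (n + 3) (half 0 (half a (half s i))) (half 1 (half b (half t j))) =
    (-1 : ℚ) ^ (s : ℕ) • jSeq (n + 2) (half a (half s i)) (half b (half t j))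
  rw [jSeq_apply, jSeq_apply, h0, h4, h, Rat.smul_def]
  push_cast
  rfl

theorem shift_shift_shift_one_zero_jSeq (s t a b : Fin 2) :
    shift s t (shift a b (shift 1 0 jSeq)) = (-1 : ℚ) ^ (t : ℕ) • shift s t (shift a b jSeq) := by
  have h := congrArg transposeSeq (shift_shift_shift_zero_one_jSeq t s b a)
  rw [← shift_transposeSeq, ← shift_transposeSeq, ← shift_transposeSeq, transposeSeq_jSeq] at h
  rw [h]
  change (-1 : ℚ) ^ (t : ℕ) • transposeSeq (shift t s (shift b a jSeq)) = _
  rw [← shift_transposeSeq, ← shift_transposeSeq, transposeSeq_jSeq]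

theorem shift_one_one_shift_one_zero_jSeq : shift 1 1 (shift 1 0 jSeq) = 0 := by
  have h := congrArg transposeSeq shift_one_one_shift_zero_one_jSeq
  rw [← shift_transposeSeq, ← shift_transposeSeq, transposeSeq_jSeq] at h
  exact h

/-- The states of the automaton for `J`. -/
noncomputable def jState : ℕ → MatSeq
  | 0 => jSeq
  | 1 => shift 0 1 jSeq
  | 2 => shift 1 0 jSeq
  | 3 => shift 0 0 (shift 0 1 jSeq)
  | 4 => shift 0 1 (shift 0 1 jSeq)
  | 5 => shift 1 0 (shift 0 1 jSeq)
  | 6 => shift 0 0 (shift 1 0 jSeq)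
  | 7 => shift 0 1 (shift 1 0 jSeq)
  | 8 => shift 1 0 (shift 1 0 jSeq)
  | _ => 0

theorem shift_zero_zero_jSeq : shift 0 0 jSeq = jSeq := shift_zero_zero_toSeq _

theorem isAutomaton_jState :
    IsAutomaton (tableShift jTable) (fun a => jInit.getD a 0) jState where
  shift_eq s t a := by
    match a with
    | 0 | 1 | 2 | 3 | 4 | 5 | 6 | 7 | 8 =>
      fin_cases s <;> fin_cases t <;>
        simp [tableShift, jTable, jState, shift_zero_zero_jSeq, shift_one_one_jSeq,
          shift_one_one_shift_zero_one_jSeq, shift_one_one_shift_one_zero_jSeq,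
          shift_shift_shift_zero_one_jSeq, shift_shift_shift_one_zero_jSeq]
    | a + 9 => simp [tableShift, jTable, jState]
  corner_eq a := by
    have h12 : pascalJ 1 2 = -1 := by decide
    have h21 : pascalJ 2 1 = -1 := by decide
    match a with
    | 0 | 1 | 2 | 3 | 4 | 5 | 6 | 7 | 8 =>
      simp [jState, jInit, corner_apply, jSeq_apply, half_val, h12, h21]
      try decide
    | a + 9 => simp [jState, jInit]

/-- The diagonal factor. -/
noncomputable def diagG : Matrix ℕ ℕ ℂ := Matrix.diagonal fun k => (g k : ℂ)

theorem diagG_add {n i j : ℕ} (hi : i < 4 * 2 ^ n) :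
    diagG (i + 4 * 2 ^ n) (j + 4 * 2 ^ n) =
      (if Even (i / 2 ^ n) then 3 else 1 / 3 : ℚ) • diagG i j := by
  by_cases hij : i = j
  · subst hij
    rw [diagG, Matrix.diagonal_apply_eq, Matrix.diagonal_apply_eq, g_add hi, Rat.smul_def]
    push_cast
    rfl
  · rw [diagG, Matrix.diagonal_apply_ne _ hij, Matrix.diagonal_apply_ne _ (by omega), smul_zero]

theorem shift_shift_shift_one_one_diagG (s t a b : Fin 2) :
    shift s t (shift a b (shift 1 1 (toSeq diagG))) =
      (if s = 0 then 3 else 1 / 3 : ℚ) • shift s t (shift a b (toSeq diagG)) := by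
  funext n
  ext i j
  have hi := half_half_lt s a i
  have h := diagG_add (j := half b (half t j)) hi.1
  have h1 : Even (2 * (a : ℕ) + s) ↔ s = 0 := by
    fin_cases s <;> simp [parity_simps]
  have h4 : ∀ k : Fin (2 ^ (n + 2)), (half 1 k : ℕ) = k + 4 * 2 ^ n := fun k => by
    rw [half_val 1]; simp only [Fin.val_one]; ring
  simp only [hi.2, h1] at h
  rw [← h4, ← h4] at h
  exact h

/-- The states of the automaton for the diagonal factor. -/
noncomputable def dState : ℕ → MatSeq
  | 0 => toSeq diagG
  | 1 => shift 1 1 (toSeq diagG)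
  | 2 => shift 0 0 (shift 1 1 (toSeq diagG))
  | 3 => shift 1 1 (shift 1 1 (toSeq diagG))
  | _ => 0

/-- All matrices of the sequence are diagonal. -/
def IsDiagSeq (A : MatSeq) : Prop := ∀ n i j, i ≠ j → A n i j = 0

theorem isDiagSeq_diagG : IsDiagSeq (toSeq diagG) := fun n i j hij => by
  rw [toSeq_apply, diagG, Matrix.diagonal_apply_ne _ fun h => hij (Fin.ext h)]

theorem IsDiagSeq.shift_self {A : MatSeq} (hA : IsDiagSeq A) (s : Fin 2) :
    IsDiagSeq (shift s s A) := fun n i j hij =>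
  hA _ _ _ fun h => hij (by simpa using congrArg low h)

theorem IsDiagSeq.shift_of_ne {A : MatSeq} (hA : IsDiagSeq A) {s t : Fin 2} (hst : s ≠ t) :
    shift s t A = 0 := by
  funext n
  ext i j
  exact hA _ _ _ fun h => hst (by simpa using congrArg high h)

theorem isDiagSeq_dState (a : ℕ) : IsDiagSeq (dState a) := by
  match a with
  | 0 => exact isDiagSeq_diagG
  | 1 => exact isDiagSeq_diagG.shift_self 1
  | 2 => exact (isDiagSeq_diagG.shift_self 1).shift_self 0
  | 3 => exact (isDiagSeq_diagG.shift_self 1).shift_self 1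
  | a + 4 => exact fun _ _ _ _ => rfl

theorem isAutomaton_dState :
    IsAutomaton (tableShift dTable) (fun a => dInit.getD a 0) dState where
  shift_eq s t a := by
    by_cases hst : s = t
    · subst hst
      match a with
      | 0 | 1 | 2 | 3 =>
        fin_cases s <;>
          simp [tableShift, dTable, dState, shift_zero_zero_toSeq, shift_shift_shift_one_one_diagG]
      | a + 4 => simp [tableShift, dTable, dState]
    · rw [(isDiagSeq_dState a).shift_of_ne hst]
      match a with
      | 0 | 1 | 2 | 3 => fin_cases s <;> fin_cases t <;> simp_all [tableShift, dTable]
      | a + 4 => simp [tableShift, dTable]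
  corner_eq a := by
    have h1 := gAbs_eq 1
    have h2 := gAbs_eq 2
    have h3 := gAbs_eq 3
    rw [show e 1 = 0 from rfl] at h1
    rw [show e 2 = 1 from rfl] at h2
    rw [show e 3 = -1 from rfl] at h3
    norm_num [gAbs_zero] at h1 h2 h3
    have hg : ∀ m, g m = (-1) ^ m * gAbs m := fun m => rfl
    match a with
    | 0 | 1 | 2 | 3 =>
      norm_num [dState, dInit, corner_apply, toSeq_apply, half_val, diagG, hg, h1, h2, h3,
        gAbs_zero]
    | a + 4 => simp [dState, dInit]

/-! ### The factorization -/

/-- The states of the automaton for the lower triangular factor. -/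
noncomputable def lState : ℕ → MatSeq := automaton (tableShift lTable) fun a => lInit.getD a 0

theorem isAutomaton_lState :
    IsAutomaton (tableShift lTable) (fun a => lInit.getD a 0) lState :=
  isAutomaton_automaton _ _

/-- The products `lState a * dState d * (lState b)ᵗ`, numbered by `80 a + 20 d + b`, and the states
for `J`, numbered from `1600`. -/
noncomputable def prodState (k : ℕ) : MatSeq :=
  if k < 1600 then
    lState (k / 80) * dState (k / 20 % 4) * transposeSeq (lState (k % 20))
  else jState (k - 1600)

/-- The form in products obtained from one form for each of the three factors. -/
def tensor (u v w : Form) : Form :=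
  u.flatMap fun p => v.flatMap fun q => w.map fun r =>
    (80 * p.1 + 20 * q.1 + r.1, p.2 * q.2 * r.2)

/-- The shifts of the products and of the states for `J`. -/
def prodShift (s t : Fin 2) (k : ℕ) : Form :=
  if k < 1600 then
    tensor (tableShift lTable s 0 (k / 80)) (tableShift dTable 0 0 (k / 20 % 4))
        (tableShift lTable t 0 (k % 20)) ++
      tensor (tableShift lTable s 1 (k / 80)) (tableShift dTable 1 1 (k / 20 % 4))
        (tableShift lTable t 1 (k % 20))
  else (tableShift jTable s t (k - 1600)).map fun p => (1600 + p.1, p.2)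

/-- The corners of the products and of the states for `J`. -/
def prodCorner (k : ℕ) : ℚ :=
  if k < 1600 then
    lInit.getD (k / 80) 0 * dInit.getD (k / 20 % 4) 0 * lInit.getD (k % 20) 0
  else jInit.getD (k - 1600) 0

theorem ev_flatMap {α M : Type*} [AddCommGroup M] [Module ℚ M] (G : ℕ → M) (l : List α)
    (f : α → Form) : Form.ev G (l.flatMap f) = (l.map fun a => Form.ev G (f a)).sum := by
  induction l with
  | nil => simp
  | cons a l ih => simp [Form.ev_append, ih]

/-- Trilinear expansion. The hypothesis concerns only generators that occur, since the mixed-radix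
numbering is injective only on bounded indices. -/
theorem ev_tensor {R : Type*} [Ring R] [Algebra ℚ R] (X Y Z G : ℕ → R) {u v w : Form}
    (h : ∀ p ∈ u, ∀ q ∈ v, ∀ r ∈ w, G (80 * p.1 + 20 * q.1 + r.1) = X p.1 * Y q.1 * Z r.1) :
    Form.ev G (tensor u v w) = Form.ev X u * Form.ev Y v * Form.ev Z w := by
  rw [tensor, ev_flatMap]
  simp only [ev_flatMap]
  have h1 : ∀ p ∈ u, ∀ q ∈ v,
      Form.ev G (w.map fun r => (80 * p.1 + 20 * q.1 + r.1, p.2 * q.2 * r.2)) =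
        (p.2 • X p.1) * (q.2 • Y q.1) * Form.ev Z w := by
    intro p hp q hq
    rw [Form.ev, Form.ev, ← List.sum_map_mul_left, List.map_map]
    refine congrArg List.sum (List.map_congr_left fun r hr => ?_)
    simp only [Function.comp, h p hp q hq r hr, smul_mul_assoc, mul_smul_comm, smul_smul]
    congr 1
    ring
  have h2 : ∀ p ∈ u, (v.map fun q =>
      Form.ev G (w.map fun r => (80 * p.1 + 20 * q.1 + r.1, p.2 * q.2 * r.2))).sum =
        (p.2 • X p.1) * Form.ev Y v * Form.ev Z w := by
    intro p hp
    rw [List.map_congr_left (h1 p hp), List.sum_map_mul_right, List.sum_map_mul_left]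
    rfl
  rw [List.map_congr_left h2]
  simp only [mul_assoc]
  rw [List.sum_map_mul_right]
  rfl

/-- Transposition as a linear map. -/
def transposeLinear : MatSeq →ₗ[ℚ] MatSeq where
  toFun := transposeSeq
  map_add' _ _ := rfl
  map_smul' _ _ := rfl

theorem transposeSeq_ev (X : ℕ → MatSeq) (f : Form) :
    transposeSeq (Form.ev X f) = Form.ev (fun a => transposeSeq (X a)) f :=
  Form.map_ev X transposeLinear f

theorem ev_tensor_table (s t u : Fin 2) (a d b : ℕ) :
    Form.ev prodState
      (tensor (tableShift lTable s u a) (tableShift dTable u u d) (tableShift lTable t u b)) =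
      shift s u (lState a) * shift u u (dState d) * transposeSeq (shift t u (lState b)) := by
  have hl : boundedBy lTable 20 = true := by decide +kernel
  have hd : boundedBy dTable 4 = true := by decide +kernel
  rw [ev_tensor lState dState (fun a => transposeSeq (lState a)), isAutomaton_lState.shift_eq,
    isAutomaton_dState.shift_eq, isAutomaton_lState.shift_eq, transposeSeq_ev]
  intro p hp q hq r hr
  have h1 := lt_of_mem_tableShift hl _ _ _ hp
  have h2 := lt_of_mem_tableShift hd _ _ _ hq
  have h3 := lt_of_mem_tableShift hl _ _ _ hr
  have e1 : (80 * p.1 + 20 * q.1 + r.1) / 80 = p.1 := by omega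
  have e2 : (80 * p.1 + 20 * q.1 + r.1) / 20 % 4 = q.1 := by omega
  have e3 : (80 * p.1 + 20 * q.1 + r.1) % 20 = r.1 := by omega
  rw [prodState, if_pos (by omega), e1, e2, e3]

/-- The middle factor is diagonal, so its off-diagonal corners vanish and only two of the four block
products survive. -/
theorem isAutomaton_prodState : IsAutomaton prodShift prodCorner prodState where
  shift_eq s t k := by
    by_cases hk : k < 1600
    · rw [prodShift, if_pos hk, Form.ev_append, ev_tensor_table, ev_tensor_table, prodState,
        if_pos hk, shift_mul, shift_mul, shift_mul,
        (isDiagSeq_dState _).shift_of_ne (by decide : (0 : Fin 2) ≠ 1),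
        (isDiagSeq_dState _).shift_of_ne (by decide : (1 : Fin 2) ≠ 0),
        shift_transposeSeq, shift_transposeSeq]
      simp
    · rw [prodShift, if_neg hk, prodState, if_neg hk, isAutomaton_jState.shift_eq, Form.ev,
        Form.ev, List.map_map]
      refine congrArg List.sum (List.map_congr_left fun p _ => ?_)
      simp [prodState]
  corner_eq k := by
    by_cases hk : k < 1600
    · rw [prodState, if_pos hk, prodCorner, if_pos hk, corner_mul, corner_mul,
        corner_transposeSeq, isAutomaton_lState.corner_eq, isAutomaton_dState.corner_eq,
        isAutomaton_lState.corner_eq]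
      push_cast
      rfl
    · rw [prodState, if_neg hk, prodCorner, if_neg hk, isAutomaton_jState.corner_eq]

/-- Generator `0` is the product `L D Lᵗ` of the initial states and generator `1600` is `J`. This
computation is the sole justification that the table chosen for `L` is the right one. -/
theorem closes_factorization :
    Form.closes prodShift prodCorner 400 [] [[(0, 1), (1600, -1)]] = true := by
  decide +kernel

theorem jSeq_eq : jSeq = lState 0 * toSeq diagG * transposeSeq (lState 0) := by
  obtain ⟨W, hW, hW'⟩ := Form.exists_stable_of_closes prodState
    (fun s t => (shift s t).restrictScalars ℚ) isAutomaton_prodState.shift_eq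
    (corner.restrictScalars ℚ) (1 : ℂ)
    (fun k => by
      rw [LinearMap.restrictScalars_apply, isAutomaton_prodState.corner_eq, Rat.smul_def, mul_one])
    400 [] [[(0, 1), (1600, -1)]] (by simp) closes_factorization
  have h := eq_zero_of_stable hW' (hW (Form.ev_mem_evSpan prodState (List.mem_singleton_self _)))
  have h' : Form.ev prodState [(0, 1), (1600, -1)] =
      lState 0 * toSeq diagG * transposeSeq (lState 0) - jSeq := by
    simp [prodState, dState, jState, sub_eq_add_neg]
  rw [h', sub_eq_zero] at h
  exact h.symm

/-! ### Infinite matrices -/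

theorem apply_add_of_shift_zero_zero {A : MatSeq} (hA : shift 0 0 A = A) {n i j : ℕ}
    (hi : i < 2 ^ n) (hj : j < 2 ^ n) (m : ℕ) :
    A (n + m) ⟨i, hi.trans_le (Nat.pow_le_pow_right two_pos (Nat.le_add_right n m))⟩
      ⟨j, hj.trans_le (Nat.pow_le_pow_right two_pos (Nat.le_add_right n m))⟩ =
      A n ⟨i, hi⟩ ⟨j, hj⟩ := by
  induction m with
  | zero => rfl
  | succ m ih =>
    rw [← ih]
    conv_rhs => rw [← hA]
    rw [shift_apply]
    congr 1 <;> ext <;> simp [half_val]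

/-- Being fixed by `shift 0 0` means that each matrix is the upper left corner of the next. The
entry at `(i, j)` can be read at size `2 ^ (i + j)`, which exceeds both indices. -/
theorem exists_toSeq_eq {A : MatSeq} (hA : shift 0 0 A = A) : ∃ M : Matrix ℕ ℕ ℂ, toSeq M = A := by
  have hlt : ∀ i j : ℕ, i < 2 ^ (i + j) := fun i j =>
    Nat.lt_two_pow_self.trans_le (Nat.pow_le_pow_right two_pos (Nat.le_add_right i j))
  have hlt' : ∀ i j : ℕ, j < 2 ^ (i + j) := fun i j =>
    Nat.lt_two_pow_self.trans_le (Nat.pow_le_pow_right two_pos (Nat.le_add_left j i))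
  refine ⟨Matrix.of fun i j => A (i + j) ⟨i, hlt i j⟩ ⟨j, hlt' i j⟩, ?_⟩
  funext n
  ext i j
  rw [toSeq_apply, Matrix.of_apply, ← apply_add_of_shift_zero_zero hA (hlt i j) (hlt' i j) n,
    ← apply_add_of_shift_zero_zero hA i.isLt j.isLt (i + j)]
  have : ∀ m m' (h : m = m') (hi : (i : ℕ) < 2 ^ m) (hj : (j : ℕ) < 2 ^ m),
      A m ⟨i, hi⟩ ⟨j, hj⟩ = A m' ⟨i, h ▸ hi⟩ ⟨j, h ▸ hj⟩ := by
    rintro m _ rfl _ _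
    rfl
  exact this _ _ (add_comm _ _) _ _

/-- Induction on blocks: the diagonal blocks stay in `S` and the upper right block is zero. -/
theorem unitriangular_of_stable {S : Set MatSeq}
    (hS : ∀ A ∈ S, corner A = 1 ∧ shift 0 0 A ∈ S ∧ shift 0 1 A = 0 ∧ shift 1 1 A ∈ S)
    (n : ℕ) {A : MatSeq} (hA : A ∈ S) (i j : Fin (2 ^ n)) :
    (i = j → A n i j = 1) ∧ (i < j → A n i j = 0) := by
  induction n generalizing A with
  | zero =>
    rw [fin_pow_zero i, fin_pow_zero j]
    exact ⟨fun _ => (hS A hA).1, fun h => absurd h (lt_irrefl _)⟩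
  | succ n ih =>
    obtain ⟨-, h00, h01, h11⟩ := hS A hA
    obtain ⟨⟨s, i⟩, rfl⟩ := (halfEquiv n).surjective i
    obtain ⟨⟨t, j⟩, rfl⟩ := (halfEquiv n).surjective j
    change (half s i = half t j → shift s t A n i j = 1) ∧
      (half s i < half t j → shift s t A n i j = 0)
    have hi := i.isLt
    have hj := j.isLt
    rw [Fin.ext_iff, Fin.lt_def, half_val, half_val]
    obtain rfl | rfl : s = 0 ∨ s = 1 := by omega
    all_goals obtain rfl | rfl : t = 0 ∨ t = 1 := by omega
    · exact ⟨fun h => (ih h00 i j).1 (Fin.ext (by simpa using h)),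
        fun h => (ih h00 i j).2 (Fin.lt_def.mpr (by simpa using h))⟩
    · refine ⟨fun h => ?_, fun _ => by rw [h01]; rfl⟩
      simp at h
      omega
    · constructor <;> intro h <;> simp at h <;> omega
    · exact ⟨fun h => (ih h11 i j).1 (Fin.ext (by simpa using h)),
        fun h => (ih h11 i j).2 (Fin.lt_def.mpr (by simpa using h))⟩

theorem lState_unitriangular (n : ℕ) (i j : Fin (2 ^ n)) :
    (i = j → lState 0 n i j = 1) ∧ (i < j → lState 0 n i j = 0) := by
  -- These are the states reached from state `0` by diagonal corners.
  refine unitriangular_of_stable (S := {lState 0, lState 2, lState 7, lState 9}) ?_ n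
    (by simp) i j
  have h := isAutomaton_lState
  rintro A (rfl | rfl | rfl | rfl) <;>
    simp [h.shift_eq, h.corner_eq, tableShift, lTable, lInit]

/-- The sum for an entry in row `i` stops at `k = i` by triangularity, so it is the same for every
size `N > i`. A factorization known at sizes `2 ^ m` thus restricts to every size `n`. -/
theorem det_eq_prod_of_factorization {R : Type*} [CommRing R] {M L : Matrix ℕ ℕ R} {d : ℕ → R}
    (h1 : ∀ i, L i i = 1) (h0 : ∀ i j, i < j → L i j = 0)
    (h : ∀ i j, ∃ N, i < N ∧ M i j = ∑ k ∈ Finset.range N, L i k * d k * L j k) (n : ℕ) :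
    (M.submatrix (fun i : Fin n => (i : ℕ)) fun j : Fin n => (j : ℕ)).det =
      ∏ k ∈ Finset.range n, d k := by
  set Ln : Matrix (Fin n) (Fin n) R := L.submatrix (fun i => (i : ℕ)) fun j => (j : ℕ) with hLn
  have hM : M.submatrix (fun i : Fin n => (i : ℕ)) (fun j : Fin n => (j : ℕ)) =
      Ln * Matrix.diagonal (fun k : Fin n => d k) * Ln.transpose := by
    ext i j
    obtain ⟨N, hN, hij⟩ := h i j
    rw [Matrix.mul_apply, Matrix.submatrix_apply, hij]
    simp only [Matrix.mul_diagonal, Matrix.transpose_apply, hLn, Matrix.submatrix_apply]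
    rw [Fin.sum_univ_eq_sum_range (fun k => L i k * d k * L j k)]
    have key : ∀ m, (i : ℕ) < m → ∑ k ∈ Finset.range m, L i k * d k * L j k =
        ∑ k ∈ Finset.range (i + 1), L i k * d k * L j k := fun m hm => by
      refine (Finset.sum_subset (Finset.range_subset_range.mpr hm) fun k _ hk => ?_).symm
      rw [h0 i k (by simpa using hk), zero_mul, zero_mul]
    rw [key N hN, key n i.isLt]
  have hdet : Ln.det = 1 := by
    rw [Matrix.det_of_isLowerTriangular Ln fun i j hij => h0 i j hij]
    simp [hLn, h1]
  rw [hM, Matrix.det_mul, Matrix.det_mul, Matrix.det_transpose, hdet, Matrix.det_diagonal,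
    one_mul, mul_one, Finset.prod_range]

/-! ### Powers of `3` -/

/-- `x` is a power of `3` with integral exponent, up to sign. -/
def IsSignedPow (x : ℚ) : Prop := ∃ z : ℤ, x = 3 ^ z ∨ x = -3 ^ z

theorem IsSignedPow.mul {x y : ℚ} (hx : IsSignedPow x) (hy : IsSignedPow y) :
    IsSignedPow (x * y) := by
  obtain ⟨z, hz⟩ := hx
  obtain ⟨w, hw⟩ := hy
  refine ⟨z + w, ?_⟩
  rw [zpow_add₀ (by norm_num)]
  rcases hz with rfl | rfl <;> rcases hw with rfl | rfl <;> simp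

theorem isSignedPow_one : IsSignedPow 1 := ⟨0, by simp⟩

theorem isSignedPow_g (n : ℕ) : IsSignedPow (g n) := by
  have h1 : IsSignedPow ((-1) ^ n) := ⟨0, by simpa using neg_one_pow_eq_or ℚ n⟩
  refine h1.mul ?_
  change IsSignedPow (gAbs n)
  rw [gAbs_eq_prod le_rfl]
  exact Finset.prod_induction _ IsSignedPow (fun _ _ => IsSignedPow.mul) isSignedPow_one
    fun k _ => ⟨_, Or.inl rfl⟩

/-- If the exponent is `-k`, then `m * 3 ^ k = ±1`, so `m` is a unit of `ℤ` and exponent `0` serves.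
-/
theorem exists_eq_pow_of_isSignedPow {m : ℤ} (h : IsSignedPow (m : ℚ)) :
    ∃ k : ℕ, m = 3 ^ k ∨ m = -3 ^ k := by
  obtain ⟨z, hz⟩ := h
  obtain ⟨k, rfl | rfl⟩ := z.eq_nat_or_neg
  · exact ⟨k, by exact_mod_cast hz⟩
  · have h3 : (3 : ℚ) ^ k ≠ 0 := by positivity
    have h1 : (m : ℚ) * 3 ^ k = 1 ∨ (m : ℚ) * 3 ^ k = -1 := by
      rw [zpow_neg, zpow_natCast] at hz
      rcases hz with hz | hz <;> rw [hz]
      · left; field_simp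
      · right; field_simp
    have h2 : m * 3 ^ k = 1 ∨ m * 3 ^ k = -1 := by exact_mod_cast h1
    refine ⟨0, ?_⟩
    have hu : IsUnit m := by
      rcases h2 with h2 | h2
      · exact IsUnit.of_mul_eq_one _ h2
      · exact IsUnit.of_mul_eq_one (-3 ^ k) (by linarith)
    simpa using Int.isUnit_iff.mp hu

/-! ### Complexities -/

/-- Every state below `N` other than `0` is the shift of a state with a smaller number. -/
def reachable (T : List (List Form)) (N : ℕ) : Bool :=
  (List.range N).all fun a => decide (a = 0) || (List.range a).any fun b =>
    [0, 1].any fun s => [0, 1].any fun t => decide (tableShift T s t b = [(a, 1)])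

theorem complexity_eq_of_table {T : List (List Form)} {e : ℕ → ℚ} {X : ℕ → MatSeq}
    (h : IsAutomaton (tableShift T) e X) {N : ℕ} (hN : 0 < N) (hT : boundedBy T N = true)
    (hreach : reachable T N = true) {ws : List (List (Fin 2 × Fin 2))}
    (hws : IsAutomaton.separates (tableShift T) e N ws = true) : complexity (X 0) = N := by
  refine h.complexity_eq hN (fun a _ s t p hp => lt_of_mem_tableShift hT s t a hp)
    (fun a ha ha0 => ?_) hws
  have := List.all_eq_true.mp hreach a (List.mem_range.mpr ha)
  rw [decide_eq_false ha0, Bool.false_or, List.any_eq_true] at this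
  obtain ⟨b, hb, hb'⟩ := this
  refine ⟨b, List.mem_range.mp hb, ?_⟩
  rw [List.any_eq_true] at hb'
  obtain ⟨s, -, hs⟩ := hb'
  rw [List.any_eq_true] at hs
  obtain ⟨t, -, ht⟩ := hs
  exact ⟨s, t, by simpa using ht⟩

/-- In this and the next two results, the words in `ws` locate as many entries as there are states,
and the resulting square matrix is invertible. -/
theorem complexity_jSeq : complexity jSeq = 9 :=
  complexity_eq_of_table isAutomaton_jState (N := 9) (by norm_num) (by decide +kernel)
    (by decide +kernel)
    (ws := [[], [(0, 0)], [(0, 1)], [(1, 0)], [(0, 0), (0, 1)], [(0, 0), (1, 0)], [(0, 1), (0, 0)],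
      [(0, 1), (1, 0)], [(1, 0), (0, 0)]]) (by decide +kernel)

theorem complexity_diagG : complexity (toSeq diagG) = 4 :=
  complexity_eq_of_table isAutomaton_dState (N := 4) (by norm_num) (by decide +kernel)
    (by decide +kernel) (ws := [[], [(0, 0)], [(1, 1)], [(0, 0), (1, 1)]]) (by decide +kernel)

theorem complexity_lState : complexity (lState 0) = 20 :=
  complexity_eq_of_table isAutomaton_lState (N := 20) (by norm_num) (by decide +kernel)
    (by decide +kernel)
    (ws := [[], [(0, 0)], [(0, 1)], [(1, 0)], [(1, 1)], [(0, 0), (0, 0)], [(0, 0), (0, 1)],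
      [(0, 0), (1, 0)], [(0, 0), (1, 1)], [(0, 1), (0, 0)], [(0, 1), (0, 1)], [(0, 1), (1, 0)],
      [(0, 1), (1, 1)], [(1, 0), (0, 0)], [(1, 0), (0, 1)], [(1, 0), (1, 1)], [(1, 1), (0, 0)],
      [(1, 1), (0, 1)], [(1, 1), (1, 0)], [(0, 0), (0, 1), (0, 0)]]) (by decide +kernel)

/-! ### The determinant -/

theorem det_J (L : Matrix ℕ ℕ ℂ) (hL : toSeq L = lState 0) (h1 : ∀ i, L i i = 1)
    (h0 : ∀ i j, i < j → L i j = 0) (n : ℕ) :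
    ((J n).det : ℚ) = ∏ k ∈ Finset.range n, g k := by
  have h := det_eq_prod_of_factorization (M := pascalJ.map fun x : ℤ => (x : ℂ)) (L := L)
    (d := fun k => (g k : ℂ)) h1 h0 (fun i j => by
      have hi : i < 2 ^ (i + j) :=
        Nat.lt_two_pow_self.trans_le (Nat.pow_le_pow_right two_pos (Nat.le_add_right i j))
      have hj : j < 2 ^ (i + j) :=
        Nat.lt_two_pow_self.trans_le (Nat.pow_le_pow_right two_pos (Nat.le_add_left j i))
      refine ⟨2 ^ (i + j), hi, ?_⟩
      have h2 := congrFun (congrFun (congrFun jSeq_eq (i + j)) ⟨i, hi⟩) ⟨j, hj⟩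
      rw [← hL] at h2
      have h3 : (toSeq L * toSeq diagG) (i + j) =
          toSeq L (i + j) * Matrix.diagonal fun k : Fin (2 ^ (i + j)) => (g k : ℂ) := by
        rw [Pi.mul_apply]
        congr 1
        ext k l
        simp [toSeq_apply, diagG, Matrix.diagonal_apply, Fin.ext_iff]
      rw [Pi.mul_apply, h3, Matrix.mul_apply] at h2
      simp only [Matrix.mul_diagonal] at h2
      rw [← Fin.sum_univ_eq_sum_range (fun k => L i k * (g k : ℂ) * L j k)]
      exact h2) n
  have h4 : ((J n).det : ℂ) = ∏ k ∈ Finset.range n, (g k : ℂ) := by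
    rw [← h]
    exact Int.cast_det (J n)
  refine Rat.cast_injective (α := ℂ) ?_
  rw [Rat.cast_intCast, Rat.cast_prod]
  exact h4

end JacobiPascal

theorem mainTheorem4 :
    (∀ n : ℕ,
      ((JacobiPascal.J n).det : ℚ) = ∏ k ∈ Finset.range n, JacobiPascal.g k ∧
      ∃ m : ℕ, (JacobiPascal.J n).det = 3 ^ m ∨ (JacobiPascal.J n).det = -3 ^ m) ∧
    JacobiPascal.complexity
      (JacobiPascal.toSeq (JacobiPascal.pascalJ.map (fun x : ℤ => (x : ℂ)))) = 9 ∧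
    ∃ L D : Matrix ℕ ℕ ℂ,
      (∀ i, L i i = 1) ∧ (∀ i j, i < j → L i j = 0) ∧ D.IsDiag ∧
      JacobiPascal.toSeq (JacobiPascal.pascalJ.map (fun x : ℤ => (x : ℂ))) =
        JacobiPascal.toSeq L * JacobiPascal.toSeq D *
          JacobiPascal.transposeSeq (JacobiPascal.toSeq L) ∧
      JacobiPascal.complexity (JacobiPascal.toSeq L) = 20 ∧
      JacobiPascal.complexity (JacobiPascal.toSeq D) = 4 := by
  open JacobiPascal in
  -- The first row of the table sends state `0` to itself under `shift 0 0`, so this state comes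
  -- from an infinite matrix.
  obtain ⟨L, hL⟩ := exists_toSeq_eq (A := lState 0) (by
    rw [isAutomaton_lState.shift_eq]
    simp [tableShift, lTable])
  have hLn : ∀ n (i j : Fin (2 ^ n)), L i j = lState 0 n i j := fun n i j => by
    rw [← hL, toSeq_apply]
  have hlt : ∀ i j : ℕ, i ≤ j → i < 2 ^ j := fun i j h => h.trans_lt Nat.lt_two_pow_self
  have h1 : ∀ i, L i i = 1 := fun i => by
    rw [hLn i ⟨i, hlt i i le_rfl⟩ ⟨i, hlt i i le_rfl⟩]
    exact (lState_unitriangular i _ _).1 rfl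
  have h0 : ∀ i j, i < j → L i j = 0 := fun i j hij => by
    rw [hLn j ⟨i, hlt i j hij.le⟩ ⟨j, hlt j j le_rfl⟩]
    exact (lState_unitriangular j _ _).2 hij
  refine ⟨fun n => ⟨det_J L hL h1 h0 n, exists_eq_pow_of_isSignedPow ?_⟩, complexity_jSeq, L, diagG,
    h1, h0, Matrix.isDiag_diagonal _, by rw [hL]; exact jSeq_eq, by rw [hL]; exact complexity_lState,
    complexity_diagG⟩
  rw [det_J L hL h1 h0 n]
  exact Finset.prod_induction _ IsSignedPow (fun _ _ => IsSignedPow.mul) isSignedPow_one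
    fun k _ => isSignedPow_g k
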